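/- For a real number $a$ with $1<a\le 2$ let $$\alpha_a(dw)=\frac{a}{(1+\log(1+w))^{a+1}}\,\mathbf 1_{(0,\infty)}(w)\,\frac{dw}{1+w}.$$ Let $FT_1$ be the set of probability measures $\alpha$ on $\mathbb R$ such that $\int_{\mathbb R}\log(1+|x|)\,\alpha(dx)<\infty$. For $\alpha\in FT_1$ let $\mu(\alpha)$ be the law of the random mean of the Dirichlet random probability with parameter measure $\alpha$, i.e. the law of $$X=\sum_{n=1}^\infty W_nB_n,\qquad W_n=Y_n\prod_{k=1}^{n-1}(1-Y_k),$$ where $B_1,Y_1,B_2,Y_2,\ldots$ are independent, $B_n\sim\alpha$ and $Y_n\sim\beta(1,1)$ (the uniform law on $(0,1)$). Then for every $1<a\le2$: $\alpha_a\in FT_1$; for $\alpha=\alpha_a$ the series defining $X$ converges absolutely almost surely, so that $\mu(\alpha_a)$ is a well-defined probability on $\mathbb R$; and $\mathbb E\log(1+|X|)=\infty$ for $X\sim\mu(\alpha_a)$, that is, $\mu(\alpha_a)\notin FT_1$. In particular, there exists a probability $\alpha\in FT_1$ such that $\mu(\alpha)\notin FT_1$. -/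

import Mathlib

open MeasureTheory ProbabilityTheory
open scoped ENNReal

/-- The class of probabilities `α` on `E` with `∫ log (1 + ‖x‖) α(dx) < ∞`. For
`E = ℝ` it is the class `FT_1`, for `E = EuclideanSpace ℝ (Fin d)` the class `FT_d`. -/
def FT (E : Type*) [NormedAddCommGroup E] [MeasurableSpace E] : Set (Measure E) :=
  {α | IsProbabilityMeasure α ∧ ∫⁻ x, ENNReal.ofReal (Real.log (1 + ‖x‖)) ∂α < ∞}

/-- The stick-breaking weights `W_n = Y_n (1 - Y_{n-1}) ⋯ (1 - Y_0)`, indexed from `0`. -/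
noncomputable def stickWeight (y : ℕ → ℝ) (n : ℕ) : ℝ :=
  y n * ∏ k ∈ Finset.range n, (1 - y k)

/-- The joint law of an independent sequence `(Y_n, B_n)`, where `Y_n` and `B_n` are
independent, `Y_n ∼ β(1, t)` and `B_n ∼ α`, on the canonical space of sequences. -/
noncomputable def stickLaw {E : Type*} [MeasurableSpace E] (t : ℝ) (α : Measure E) :
    Measure (ℕ → ℝ × E) :=
  Measure.infinitePi fun _ => (betaMeasure 1 t).prod α

/-- The `n`-th term `W_n B_n` of the series that defines the Dirichlet random mean. -/
noncomputable def stickTerm {E : Type*} [NormedAddCommGroup E] [NormedSpace ℝ E]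
    (ω : ℕ → ℝ × E) (n : ℕ) : E :=
  stickWeight (fun k => (ω k).1) n • (ω n).2

/-- `μ(tα)`: the law of the Dirichlet random mean `X_t = ∫ x P_t(dx) = ∑ W_n B_n`, where
`P_t = ∑ W_n δ_{B_n}` is the Dirichlet random probability with governing probability `α`
and intensity `t`. It is used for `t > 0` and `α ∈ FT E`. -/
noncomputable def dirichletMean {E : Type*} [NormedAddCommGroup E] [NormedSpace ℝ E]
    [MeasurableSpace E] (t : ℝ) (α : Measure E) : Measure E :=
  (stickLaw t α).map fun ω => ∑' n, stickTerm ω n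

/-- The log-Pareto measure on `(0, ∞)` with density
`a / ((1 + log (1 + w)) ^ (a + 1) (1 + w))`. -/
noncomputable def logPareto (a : ℝ) : Measure ℝ :=
  (volume.restrict (Set.Ioi 0)).withDensity fun w =>
    ENNReal.ofReal (a / (1 + Real.log (1 + w)) ^ (a + 1) * (1 / (1 + w)))

open Filter Set

/-! Let `S = ∑ |W_n B_n|` and `V = log (1 + S)`. Prepending an independent pair `(Y, B)` turns `S`
into `Y |B| + (1 - Y) S` without changing its law (`measurePreserving_seqCons`, `stickAbs_seqCons`).
This step lowers `V` by at most `-log (1 - Y)`, and when `Y ≥ 1/2` it lifts `V` to at least `log (1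
+ |B|) - log 2`.

Compare the means of `min(V, M)^2` before and after. They are equal and finite, so the expected gain
on `{Y ≥ 1/2, V ≤ K}` is at most the expected loss. The square grows at rate `2V`, so the loss is at
most `2 E V · E(-log (1 - Y))`, uniformly in `M` (`lintegral_sq_min_sub_le`). If `E V` were finite,
letting `M → ∞` would give `E log(1 + |B|)^2 < ∞` (`lintegral_stickLog_eq_top`).

The log-Pareto law with `1 < a ≤ 2` has a finite first logarithmic moment and an infinite second
one. It is carried by the positive half-line, so there `X = S` almost surely. -/

/-! ### Shift structure of independent sequences -/

/-- Prepend a term to a sequence. -/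
def seqCons {X : Type*} (p : X × (ℕ → X)) : ℕ → X
  | 0 => p.1
  | n + 1 => p.2 n

@[simp] lemma seqCons_zero {X : Type*} (p : X × (ℕ → X)) : seqCons p 0 = p.1 := rfl

@[simp] lemma seqCons_succ {X : Type*} (p : X × (ℕ → X)) (n : ℕ) :
    seqCons p (n + 1) = p.2 n := rfl

lemma measurable_seqCons {X : Type*} [MeasurableSpace X] : Measurable (seqCons (X := X)) := by
  refine measurable_pi_lambda _ fun n => ?_
  cases n with
  | zero => exact measurable_fst
  | succ n => exact (measurable_pi_apply n).comp measurable_snd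

/-- An independent sequence of common law `ν` is an independent term followed by such a
sequence. -/
lemma measurePreserving_seqCons {X : Type*} [MeasurableSpace X] (ν : Measure X)
    [IsProbabilityMeasure ν] :
    MeasurePreserving (seqCons (X := X)) (ν.prod (Measure.infinitePi fun _ : ℕ => ν))
      (Measure.infinitePi fun _ : ℕ => ν) := by
  classical
  refine ⟨measurable_seqCons, Measure.eq_infinitePi _ fun s t ht => ?_⟩
  obtain ⟨n, hn⟩ : ∃ n, s ⊆ Finset.range (n + 1) :=
    ⟨s.sup id, fun i hi => Finset.mem_range_succ_iff.2 (Finset.le_sup (f := id) hi)⟩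
  -- Padding with `univ` turns the cylinder over `s` into a box over an initial segment, which
  -- splits at coordinate `0`.
  set u : ℕ → Set X := fun i => if i ∈ s then t i else univ with hu
  have hum : ∀ i, MeasurableSet (u i) := fun i => by
    by_cases h : i ∈ s <;> simp [hu, h, ht]
  have hpre : seqCons ⁻¹' (Set.pi s t) = u 0 ×ˢ Set.pi (Finset.range n) fun i => u (i + 1) := by
    ext p
    simp only [mem_preimage, Set.mem_pi, mem_prod, Finset.mem_coe, Finset.mem_range]
    constructor
    · intro h
      refine ⟨?_, fun i _ => ?_⟩
      · by_cases h0 : 0 ∈ s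
        · simpa [hu, h0] using h 0 h0
        · simp [hu, h0]
      · by_cases hi : i + 1 ∈ s
        · simpa [hu, hi] using h (i + 1) hi
        · simp [hu, hi]
    · rintro ⟨h0, h⟩ i hi
      cases i with
      | zero => simpa [hu, hi] using h0
      | succ i =>
        have := h i (by simpa using hn hi)
        simpa [hu, hi] using this
  rw [Measure.map_apply measurable_seqCons (MeasurableSet.pi s.countable_toSet fun i _ => ht i),
    hpre, Measure.prod_prod, Measure.infinitePi_pi _ fun i _ => hum (i + 1), mul_comm,
    ← Finset.prod_range_succ' (fun i => ν (u i)), ← Finset.prod_subset hn]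
  · exact Finset.prod_congr rfl fun i hi => by simp [hu, hi]
  · intro i _ hi
    simp [hu, hi]

lemma lintegral_prod_infinitePi {X : Type*} [MeasurableSpace X] (ν : Measure X)
    [IsProbabilityMeasure ν] {f : X → ℝ≥0∞} (hf : Measurable f) (n : ℕ) :
    ∫⁻ ω, ∏ k ∈ Finset.range n, f (ω k) ∂(Measure.infinitePi fun _ : ℕ => ν)
      = (∫⁻ x, f x ∂ν) ^ n := by
  induction n with
  | zero => simp
  | succ n ih =>
    have hm : ∀ m, Measurable fun ω : ℕ → X => ∏ k ∈ Finset.range m, f (ω k) := fun m =>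
      Finset.measurable_prod _ fun k _ => hf.comp (measurable_pi_apply k)
    rw [← (measurePreserving_seqCons ν).lintegral_comp (hm _)]
    simp only [Finset.prod_range_succ', seqCons_zero, seqCons_succ]
    rw [pow_succ, ← ih, mul_comm]
    simp_rw [mul_comm _ (f _)]
    exact lintegral_prod_mul hf.aemeasurable (hm n).aemeasurable

lemma measurable_log_one_add_norm : Measurable fun x : ℝ => Real.log (1 + ‖x‖) :=
  Real.measurable_log.comp (by fun_prop)

/-! ### The uniform law on the unit interval -/

lemma betaMeasure_one_one : betaMeasure 1 1 = volume.restrict (Ioo (0 : ℝ) 1) := by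
  rw [← withDensity_indicator_one measurableSet_Ioo, betaMeasure]
  congr 1
  ext x
  by_cases hx : 0 < x ∧ x < 1
  · have : x ∈ Ioo (0 : ℝ) 1 := hx
    simp [betaPDF_eq, hx, this, ProbabilityTheory.beta, one_add_one_eq_two]
  · have : x ∉ Ioo (0 : ℝ) 1 := hx
    simp [betaPDF_eq, hx, this]

instance : IsProbabilityMeasure (betaMeasure 1 1) :=
  isProbabilityMeasureBeta one_pos one_pos

lemma ae_betaMeasure_one_one : ∀ᵐ y ∂betaMeasure 1 1, y ∈ Ioo (0 : ℝ) 1 := by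
  rw [betaMeasure_one_one]
  exact ae_restrict_mem measurableSet_Ioo

lemma lintegral_one_sub_betaMeasure_one_one :
    ∫⁻ y, ‖1 - y‖ₑ ∂betaMeasure 1 1 = ENNReal.ofReal (1 / 2) := by
  have h : ∫⁻ y, ‖1 - y‖ₑ ∂betaMeasure 1 1
      = ∫⁻ y, ENNReal.ofReal (1 - y) ∂betaMeasure 1 1 := by
    refine lintegral_congr_ae ?_
    filter_upwards [ae_betaMeasure_one_one] with y hy
    rw [Real.enorm_of_nonneg (by linarith [hy.2])]
  have hint : IntegrableOn (fun y : ℝ => 1 - y) (Ioc 0 1) :=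
    (Continuous.integrableOn_Icc (by fun_prop)).mono_set Ioc_subset_Icc_self
  rw [h, betaMeasure_one_one, restrict_Ioo_eq_restrict_Ioc,
    ← ofReal_integral_eq_lintegral_ofReal hint, ← intervalIntegral.integral_of_le zero_le_one]
  · congr 1
    rw [intervalIntegral.integral_sub (by simp) (by simp)]
    simp
    norm_num
  · filter_upwards [ae_restrict_mem measurableSet_Ioc] with y hy
    simpa using hy.2

lemma lintegral_neg_log_one_sub_betaMeasure_one_one_lt_top :
    ∫⁻ y, ENNReal.ofReal (-Real.log (1 - y)) ∂betaMeasure 1 1 < ∞ := by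
  have h : IntervalIntegrable (fun y : ℝ => Real.log (1 - y)) volume 0 1 := by
    simpa using (intervalIntegral.intervalIntegrable_log' (a := 1) (b := 0)).comp_sub_left 1
  rw [betaMeasure_one_one, restrict_Ioo_eq_restrict_Ioc]
  exact (((intervalIntegrable_iff_integrableOn_Ioc_of_le zero_le_one).1 h).neg).lintegral_lt_top

lemma betaMeasure_one_one_Ici_half :
    betaMeasure 1 1 (Ici (1 / 2)) = ENNReal.ofReal (1 / 2) := by
  have : Ici (1 / 2 : ℝ) ∩ Ioo 0 1 = Ico (1 / 2) 1 := by
    ext x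
    simp only [mem_inter_iff, mem_Ici, mem_Ioo, mem_Ico]
    constructor
    · rintro ⟨h, -, h'⟩
      exact ⟨h, h'⟩
    · rintro ⟨h, h'⟩
      exact ⟨h, by linarith, h'⟩
  rw [betaMeasure_one_one, Measure.restrict_apply measurableSet_Ici, this, Real.volume_Ico]
  norm_num

/-! ### Almost sure absolute convergence -/

/-- The total absolute mass `∑ |W_n B_n|` of the Dirichlet series. -/
noncomputable def stickAbs (ω : ℕ → ℝ × ℝ) : ℝ≥0∞ := ∑' n, ‖stickTerm ω n‖ₑ

lemma stickTerm_zero (ω : ℕ → ℝ × ℝ) : stickTerm ω 0 = (ω 0).1 * (ω 0).2 := by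
  simp [stickTerm, stickWeight]

lemma stickTerm_seqCons_succ (p : (ℝ × ℝ) × (ℕ → ℝ × ℝ)) (n : ℕ) :
    stickTerm (seqCons p) (n + 1) = (1 - p.1.1) * stickTerm p.2 n := by
  simp only [stickTerm, stickWeight, Finset.prod_range_succ', seqCons_succ, seqCons_zero,
    smul_eq_mul]
  ring

lemma measurable_stickTerm (n : ℕ) : Measurable fun ω : ℕ → ℝ × ℝ => stickTerm ω n := by
  simp only [stickTerm, stickWeight, smul_eq_mul]
  fun_prop

lemma measurable_stickAbs : Measurable stickAbs :=
  Measurable.tsum fun n => (measurable_stickTerm n).enorm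

lemma stickAbs_seqCons (p : (ℝ × ℝ) × (ℕ → ℝ × ℝ)) :
    stickAbs (seqCons p) = ‖p.1.1 * p.1.2‖ₑ + ‖1 - p.1.1‖ₑ * stickAbs p.2 := by
  rw [stickAbs, tsum_eq_zero_add' ENNReal.summable, stickTerm_zero]
  simp only [stickTerm_seqCons_succ, enorm_mul, seqCons_zero, ENNReal.tsum_mul_left]
  rfl

lemma summable_of_stickAbs_ne_top {ω : ℕ → ℝ × ℝ} (h : stickAbs ω ≠ ∞) :
    Summable fun n => stickTerm ω n := by
  have : Summable fun n => ‖stickTerm ω n‖ := by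
    have := ENNReal.summable_toReal h
    simpa using this
  exact this.of_norm

section

variable {α : Measure ℝ} [IsProbabilityMeasure α]

instance : IsProbabilityMeasure (stickLaw 1 α) := by
  unfold stickLaw
  infer_instance

lemma measurePreserving_stickLaw_eval (n : ℕ) :
    MeasurePreserving (fun ω : ℕ → ℝ × ℝ => ω n) (stickLaw 1 α) ((betaMeasure 1 1).prod α) :=
  measurePreserving_eval_infinitePi (fun _ : ℕ => (betaMeasure 1 1).prod α) n

lemma measurePreserving_stickLaw_seqCons :
    MeasurePreserving seqCons (((betaMeasure 1 1).prod α).prod (stickLaw 1 α)) (stickLaw 1 α) :=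
  measurePreserving_seqCons _

lemma ae_stickLaw_mem_Ioo : ∀ᵐ ω ∂stickLaw 1 α, ∀ n, (ω n).1 ∈ Ioo (0 : ℝ) 1 :=
  ae_all_iff.2 fun n =>
    (measurePreserving_fst.comp (measurePreserving_stickLaw_eval n)).quasiMeasurePreserving.ae
      ae_betaMeasure_one_one

lemma ae_stickLaw_snd {P : ℝ → Prop} (h : ∀ᵐ x ∂α, P x) :
    ∀ᵐ ω ∂stickLaw 1 α, ∀ n, P (ω n).2 :=
  ae_all_iff.2 fun n =>
    (measurePreserving_snd.comp (measurePreserving_stickLaw_eval n)).quasiMeasurePreserving.ae h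

/-- Borel–Cantelli: integrability of `2 log (1 + |B|)` makes the probabilities of exceeding `n`
summable. The factor `2` yields growth `exp (n / 2)`, slow enough to be beaten by the mean decay
`2^(-n)` of the sticks. -/
lemma ae_eventually_norm_snd_le_exp (hα : ∫⁻ x, ENNReal.ofReal (Real.log (1 + ‖x‖)) ∂α < ∞) :
    ∀ᵐ ω ∂stickLaw 1 α, ∀ᶠ n : ℕ in atTop, ‖(ω n).2‖ ≤ Real.exp (n / 2) := by
  have hlog : ∀ x : ℝ, 0 ≤ Real.log (1 + ‖x‖) := fun x =>
    Real.log_nonneg (by linarith [norm_nonneg x])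
  have hint : Integrable (fun x : ℝ => 2 * Real.log (1 + ‖x‖)) α := by
    refine Integrable.const_mul ⟨measurable_log_one_add_norm.aestronglyMeasurable, ?_⟩ 2
    rw [hasFiniteIntegral_iff_ofReal (Eventually.of_forall hlog)]
    exact hα
  have hsum := @tsum_prob_mem_Ioi_lt_top ℝ ⟨α⟩ ‹_› _ hint
    fun x => mul_nonneg zero_le_two (hlog x)
  have hms : ∀ n : ℕ, MeasurableSet {x : ℝ | 2 * Real.log (1 + ‖x‖) ∈ Ioi (n : ℝ)} := fun n =>
    measurableSet_lt measurable_const (measurable_log_one_add_norm.const_mul 2)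
  have key : ∑' n : ℕ, stickLaw 1 α
      {ω | (ω n).2 ∈ {x : ℝ | 2 * Real.log (1 + ‖x‖) ∈ Ioi (n : ℝ)}} ≠ ∞ := by
    refine ne_of_lt (lt_of_eq_of_lt (tsum_congr fun n => ?_) hsum)
    exact (measurePreserving_snd.comp (measurePreserving_stickLaw_eval n)).measure_preimage
      (hms n).nullMeasurableSet
  filter_upwards [ae_eventually_notMem key] with ω hω
  filter_upwards [hω] with n hn
  simp only [mem_Ioi, not_lt] at hn
  have hpos : 0 < 1 + ‖(ω n).2‖ := by positivity
  have := (Real.log_le_iff_le_exp hpos).1 (show Real.log (1 + ‖(ω n).2‖) ≤ n / 2 by linarith)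
  linarith

lemma ae_stickAbs_ne_top (hα : ∫⁻ x, ENNReal.ofReal (Real.log (1 + ‖x‖)) ∂α < ∞) :
    ∀ᵐ ω ∂stickLaw 1 α, stickAbs ω ≠ ∞ := by
  set g : ℕ → (ℕ → ℝ × ℝ) → ℝ≥0∞ := fun n ω =>
    ENNReal.ofReal (Real.exp (n / 2)) * ∏ k ∈ Finset.range n, ‖1 - (ω k).1‖ₑ with hg
  have hgm : ∀ n, Measurable (g n) := fun n => by
    refine measurable_const.mul (Finset.measurable_prod _ fun k _ => ?_)
    fun_prop
  have hgint : ∀ n, ∫⁻ ω, g n ω ∂stickLaw 1 α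
      = ENNReal.ofReal (Real.exp (1 / 2) * (1 / 2)) ^ n := fun n => by
    have h1 := lintegral_prod_infinitePi ((betaMeasure 1 1).prod α)
      (f := fun x : ℝ × ℝ => ‖1 - x.1‖ₑ) (by fun_prop) n
    have h2 : ∫⁻ x : ℝ × ℝ, ‖1 - x.1‖ₑ ∂(betaMeasure 1 1).prod α = ENNReal.ofReal (1 / 2) := by
      rw [← lintegral_one_sub_betaMeasure_one_one]
      exact measurePreserving_fst.lintegral_comp (f := fun y : ℝ => ‖1 - y‖ₑ) (by fun_prop)
    rw [hg, lintegral_const_mul _ (Finset.measurable_prod _ fun k _ => by fun_prop), stickLaw, h1,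
      h2, ← ENNReal.ofReal_pow (by norm_num), ← ENNReal.ofReal_mul (by positivity),
      ← ENNReal.ofReal_pow (by positivity), mul_pow, ← Real.exp_nat_mul]
    congr 4
    ring
  -- The ratio of the dominating geometric series is below `1` because `e < 4`.
  have hexp : Real.exp (1 / 2) * (1 / 2) < 1 := by
    have h3 : Real.exp (1 / 2) ^ 2 = Real.exp 1 := by
      rw [← Real.exp_nat_mul]
      norm_num
    nlinarith [Real.exp_one_lt_d9, Real.exp_pos (1 / 2)]
  have hfin : ∀ᵐ ω ∂stickLaw 1 α, ∑' n, g n ω < ∞ := by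
    refine ae_lt_top (Measurable.tsum hgm) ?_
    rw [lintegral_tsum fun n => (hgm n).aemeasurable]
    simp_rw [hgint]
    rw [ENNReal.tsum_geometric]
    refine ENNReal.inv_ne_top.2 (tsub_pos_of_lt ?_).ne'
    simpa using (ENNReal.ofReal_lt_one).2 hexp
  filter_upwards [hfin, ae_eventually_norm_snd_le_exp hα, ae_stickLaw_mem_Ioo] with ω h1 h2 h3
  obtain ⟨N, hN⟩ := eventually_atTop.1 h2
  have hle : ∀ n, ‖stickTerm ω (n + N)‖ₑ ≤ g (n + N) ω := fun n => by
    have hy : ‖(ω (n + N)).1‖ₑ ≤ 1 := by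
      rw [Real.enorm_of_nonneg (h3 _).1.le]
      exact ENNReal.ofReal_le_one.2 (h3 _).2.le
    have hb : ‖(ω (n + N)).2‖ₑ ≤ ENNReal.ofReal (Real.exp ((n + N : ℕ) / 2)) := by
      rw [← ofReal_norm]
      exact ENNReal.ofReal_le_ofReal (hN _ (Nat.le_add_left N n))
    have hprod : ‖∏ k ∈ Finset.range (n + N), (1 - (ω k).1)‖ₑ
        = ∏ k ∈ Finset.range (n + N), ‖1 - (ω k).1‖ₑ := by
      simp only [enorm_eq_nnnorm, nnnorm_prod, ENNReal.ofNNReal_finsetProd]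
    rw [stickTerm, stickWeight, smul_eq_mul, enorm_mul, enorm_mul, hprod, hg, mul_comm]
    refine mul_le_mul' hb ?_
    exact (mul_le_mul_left hy _).trans_eq (one_mul _)
  rw [stickAbs, ← ENNReal.summable.sum_add_tsum_nat_add' (k := N)]
  refine ENNReal.add_ne_top.2 ⟨ENNReal.sum_ne_top.2 fun n _ => enorm_ne_top, ne_of_lt ?_⟩
  refine lt_of_le_of_lt (ENNReal.tsum_le_tsum hle) (lt_of_le_of_lt ?_ h1)
  exact ENNReal.tsum_comp_le_tsum_of_injective (add_left_injective N) fun n => g n ω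

end

/-! ### The drift inequality -/

/-- Truncation at `M` is 1-Lipschitz, so when `w ≤ v` the difference of squares is at most `e` times
a sum bounded by `2v`. -/
lemma sq_min_le_sq_min_add {v w e M : ℝ} (hv : 0 ≤ v) (hw : 0 ≤ w) (he : 0 ≤ e) (hM : 0 ≤ M)
    (h : v - e ≤ w) : min v M ^ 2 ≤ min w M ^ 2 + 2 * (v * e) := by
  rcases le_total v w with hvw | hvw
  · have h1 : min v M ≤ min w M := min_le_min_right M hvw
    have h2 : 0 ≤ min v M := le_min hv hM
    nlinarith [mul_nonneg hv he]
  · have h1 : min w M ≤ min v M := min_le_min_right M hvw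
    have h2 : 0 ≤ min w M := le_min hw hM
    have h3 : min v M - min w M ≤ e := by
      rcases le_total w M with hwM | hwM
      · rw [min_eq_left hwM]
        linarith [min_le_left v M]
      · rw [min_eq_right hwM]
        linarith [min_le_right v M]
    have h4 : min v M ≤ v := min_le_left v M
    nlinarith [mul_nonneg (sub_nonneg.2 h3) (add_nonneg h2 (h2.trans h1)), mul_nonneg he hv]

/-- If the gain is positive, `v ≤ K` and `u ≤ w` already give the bound without the loss term;
otherwise only the loss counts. -/
lemma sq_min_add_sq_min_sub_le {v w e u M K : ℝ} (hv : 0 ≤ v) (hw : 0 ≤ w) (he : 0 ≤ e)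
    (hu : 0 ≤ u) (hM : 0 ≤ M) (h : v - e ≤ w) (huw : u ≤ w) (hvK : v ≤ K) :
    min v M ^ 2 + max (min u M ^ 2 - K ^ 2) 0 ≤ min w M ^ 2 + 2 * (v * e) := by
  rcases le_total (min u M ^ 2 - K ^ 2) 0 with h0 | h0
  · rw [max_eq_right h0, add_zero]
    exact sq_min_le_sq_min_add hv hw he hM h
  · rw [max_eq_left h0]
    have h1 : min u M ^ 2 ≤ min w M ^ 2 :=
      pow_le_pow_left₀ (le_min hu hM) (min_le_min_right M huw) 2
    have h2 : min v M ^ 2 ≤ K ^ 2 :=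
      pow_le_pow_left₀ (le_min hv hM) ((min_le_left v M).trans hvK) 2
    linarith [mul_nonneg hv he]

/-- The logarithmic size of the absolute series. -/
noncomputable def stickLog (ω : ℕ → ℝ × ℝ) : ℝ := Real.log (1 + (stickAbs ω).toReal)

lemma measurable_stickLog : Measurable stickLog :=
  Real.measurable_log.comp (measurable_const.add measurable_stickAbs.ennreal_toReal)

lemma stickLog_nonneg (ω : ℕ → ℝ × ℝ) : 0 ≤ stickLog ω :=
  Real.log_nonneg (by linarith [ENNReal.toReal_nonneg (a := stickAbs ω)])

lemma toReal_stickAbs_seqCons {y b : ℝ} {ω : ℕ → ℝ × ℝ} (hy : y ∈ Ioo (0 : ℝ) 1)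
    (hω : stickAbs ω ≠ ∞) :
    (stickAbs (seqCons ((y, b), ω))).toReal = y * ‖b‖ + (1 - y) * (stickAbs ω).toReal := by
  rw [stickAbs_seqCons, ENNReal.toReal_add enorm_ne_top (ENNReal.mul_ne_top enorm_ne_top hω),
    ENNReal.toReal_mul, toReal_enorm, toReal_enorm, norm_mul, Real.norm_of_nonneg hy.1.le,
    Real.norm_of_nonneg (sub_nonneg.2 hy.2.le)]

lemma stickLog_add_le_stickLog_seqCons {y b : ℝ} {ω : ℕ → ℝ × ℝ} (hy : y ∈ Ioo (0 : ℝ) 1)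
    (hω : stickAbs ω ≠ ∞) :
    stickLog ω - -Real.log (1 - y) ≤ stickLog (seqCons ((y, b), ω)) := by
  have h0 : 0 ≤ (stickAbs ω).toReal := ENNReal.toReal_nonneg
  have h1 : 0 < 1 - y := sub_pos.2 hy.2
  rw [stickLog, stickLog, toReal_stickAbs_seqCons hy hω, sub_neg_eq_add,
    ← Real.log_mul (by positivity) h1.ne']
  refine Real.log_le_log (by positivity) ?_
  nlinarith [mul_nonneg hy.1.le (norm_nonneg b), hy.1]

lemma log_sub_log_two_le_stickLog_seqCons {y b : ℝ} {ω : ℕ → ℝ × ℝ} (hy : y ∈ Ioo (0 : ℝ) 1)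
    (hy' : 1 / 2 ≤ y) (hω : stickAbs ω ≠ ∞) :
    Real.log (1 + ‖b‖) - Real.log 2 ≤ stickLog (seqCons ((y, b), ω)) := by
  have h0 : 0 ≤ (stickAbs ω).toReal := ENNReal.toReal_nonneg
  have h1 : 0 < 1 - y := sub_pos.2 hy.2
  have h2 : 0 < 1 + ‖b‖ := by positivity
  rw [stickLog, toReal_stickAbs_seqCons hy hω, ← Real.log_div h2.ne' two_ne_zero]
  refine Real.log_le_log (by positivity) ?_
  nlinarith [mul_nonneg (sub_nonneg.2 hy') (norm_nonneg b), mul_nonneg h1.le h0]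

section

variable {α : Measure ℝ} [IsProbabilityMeasure α]

lemma exists_stickLaw_stickLog_le_ne_zero :
    ∃ K : ℕ, stickLaw 1 α {ω | stickLog ω ≤ K} ≠ 0 := by
  by_contra! h
  have h1 : stickLaw 1 α (⋃ K : ℕ, {ω | stickLog ω ≤ K}) = 0 := measure_iUnion_null h
  have h2 : (⋃ K : ℕ, {ω | stickLog ω ≤ K}) = univ :=
    eq_univ_of_forall fun ω => mem_iUnion.2 (exists_nat_ge (stickLog ω))
  rw [h2, measure_univ] at h1
  exact one_ne_zero h1

/-- The drift inequality: the truncated square of `stickLog` has the same mean before and after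
prepending a term, so what a large prepended term adds is bounded by the mean loss
`2 E (stickLog) E (-log (1 - Y))`. -/
lemma lintegral_sq_min_sub_le (hα : ∫⁻ x, ENNReal.ofReal (Real.log (1 + ‖x‖)) ∂α < ∞)
    (K M : ℕ) :
    ENNReal.ofReal (1 / 2) *
        (∫⁻ b, ENNReal.ofReal
          (min (max (Real.log (1 + ‖b‖) - Real.log 2) 0) M ^ 2 - (K : ℝ) ^ 2) ∂α) *
        stickLaw 1 α {ω | stickLog ω ≤ K} ≤
      2 * (∫⁻ y, ENNReal.ofReal (-Real.log (1 - y)) ∂betaMeasure 1 1) *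
        ∫⁻ ω, ENNReal.ofReal (stickLog ω) ∂stickLaw 1 α := by
  set u : ℝ → ℝ := fun b => max (Real.log (1 + ‖b‖) - Real.log 2) 0 with hu
  set f : ℝ → ℝ≥0∞ := fun b => ENNReal.ofReal (min (u b) M ^ 2 - (K : ℝ) ^ 2) with hf
  set φ : (ℕ → ℝ × ℝ) → ℝ≥0∞ := fun ω => ENNReal.ofReal (min (stickLog ω) M ^ 2) with hφ
  set A : Set (ℕ → ℝ × ℝ) := {ω | stickLog ω ≤ K} with hA
  set H : Set ℝ := Ici (1 / 2)
  set e : ℝ → ℝ≥0∞ := fun y => ENNReal.ofReal (-Real.log (1 - y)) with he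
  set β := betaMeasure 1 1
  set P := stickLaw 1 α
  have hum : Measurable u := (measurable_log_one_add_norm.sub_const _).max measurable_const
  have hfm : Measurable f := by fun_prop
  have hφm : Measurable φ := ((measurable_stickLog.min measurable_const).pow_const 2).ennreal_ofReal
  have hAm : MeasurableSet A := measurableSet_le measurable_stickLog measurable_const
  have hem : Measurable e :=
    (Real.measurable_log.comp (measurable_const.sub measurable_id)).neg.ennreal_ofReal
  have hvm : Measurable fun ω => ENNReal.ofReal (stickLog ω) := measurable_stickLog.ennreal_ofReal
  -- Truncation at `M` serves here: the common mean is finite, hence can be cancelled at the end.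
  have hfφ : ∫⁻ ω, φ ω ∂P ≠ ∞ := by
    refine ne_of_lt (lt_of_le_of_lt (lintegral_mono (g := fun _ => ENNReal.ofReal ((M : ℝ) ^ 2))
      fun ω => ENNReal.ofReal_le_ofReal ?_) (by simp))
    exact pow_le_pow_left₀ (le_min (stickLog_nonneg ω) (Nat.cast_nonneg M)) (min_le_right _ _) 2
  have hpt : ∀ᵐ p ∂(β.prod α).prod P,
      φ p.2 + H.indicator 1 p.1.1 * f p.1.2 * A.indicator 1 p.2 ≤
        φ (seqCons p) + 2 * e p.1.1 * ENNReal.ofReal (stickLog p.2) := by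
    have h1 : ∀ᵐ p ∂(β.prod α).prod P, p.1.1 ∈ Ioo (0 : ℝ) 1 :=
      (measurePreserving_fst.comp measurePreserving_fst).quasiMeasurePreserving.ae
        ae_betaMeasure_one_one
    have h2 : ∀ᵐ p ∂(β.prod α).prod P, stickAbs p.2 ≠ ∞ :=
      measurePreserving_snd.quasiMeasurePreserving.ae (ae_stickAbs_ne_top hα)
    filter_upwards [h1, h2] with p hy hω
    obtain ⟨⟨y, b⟩, ω⟩ := p
    have hv := stickLog_nonneg ω
    have hw := stickLog_nonneg (seqCons ((y, b), ω))
    have hl : 0 ≤ -Real.log (1 - y) :=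
      neg_nonneg.2 (Real.log_nonpos (sub_nonneg.2 hy.2.le) (by linarith [hy.1]))
    have hM : (0 : ℝ) ≤ M := Nat.cast_nonneg M
    have hstep := stickLog_add_le_stickLog_seqCons (b := b) hy hω
    have hrhs : φ (seqCons ((y, b), ω)) + 2 * e y * ENNReal.ofReal (stickLog ω) =
        ENNReal.ofReal (min (stickLog (seqCons ((y, b), ω))) M ^ 2 +
          2 * (stickLog ω * -Real.log (1 - y))) := by
      rw [ENNReal.ofReal_add (by positivity) (by positivity), ENNReal.ofReal_mul zero_le_two,
        ENNReal.ofReal_mul hv, ENNReal.ofReal_ofNat, mul_assoc, mul_comm (e y)]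
    rw [hrhs]
    by_cases hyH : y ∈ H
    · by_cases hωA : ω ∈ A
      · have huw : u b ≤ stickLog (seqCons ((y, b), ω)) :=
          max_le (log_sub_log_two_le_stickLog_seqCons hy hyH hω) hw
        have := sq_min_add_sq_min_sub_le hv hw hl (le_max_right _ _ : 0 ≤ u b) hM hstep huw hωA
        simp only [indicator_of_mem hyH, indicator_of_mem hωA, Pi.one_apply, one_mul, mul_one, hf]
        rw [show ENNReal.ofReal (min (u b) M ^ 2 - (K : ℝ) ^ 2) =
            ENNReal.ofReal (max (min (u b) M ^ 2 - (K : ℝ) ^ 2) 0) by simp,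
          ← ENNReal.ofReal_add (by positivity) (le_max_right _ _)]
        exact ENNReal.ofReal_le_ofReal this
      · simp only [indicator_of_notMem hωA, mul_zero, add_zero]
        exact ENNReal.ofReal_le_ofReal (sq_min_le_sq_min_add hv hw hl hM hstep)
    · simp only [indicator_of_notMem hyH, zero_mul, add_zero]
      exact ENNReal.ofReal_le_ofReal (sq_min_le_sq_min_add hv hw hl hM hstep)
  have hint := lintegral_mono_ae hpt
  have hH1 : Measurable (H.indicator (1 : ℝ → ℝ≥0∞)) := measurable_one.indicator measurableSet_Ici
  have hA1 : Measurable (A.indicator (1 : (ℕ → ℝ × ℝ) → ℝ≥0∞)) := measurable_one.indicator hAm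
  have hHf : ∫⁻ p, H.indicator 1 p.1.1 * f p.1.2 * A.indicator 1 p.2 ∂(β.prod α).prod P
      = ENNReal.ofReal (1 / 2) * (∫⁻ b, f b ∂α) * P A := by
    rw [lintegral_prod_mul (f := fun q : ℝ × ℝ => H.indicator 1 q.1 * f q.2)
      (by fun_prop) hA1.aemeasurable, lintegral_prod_mul hH1.aemeasurable hfm.aemeasurable,
      lintegral_indicator_one measurableSet_Ici, lintegral_indicator_one hAm,
      betaMeasure_one_one_Ici_half]
  have hev : ∫⁻ p, 2 * e p.1.1 * ENNReal.ofReal (stickLog p.2) ∂(β.prod α).prod P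
      = 2 * (∫⁻ y, e y ∂β) * ∫⁻ ω, ENNReal.ofReal (stickLog ω) ∂P := by
    rw [lintegral_prod_mul (f := fun q : ℝ × ℝ => 2 * e q.1) (by fun_prop) hvm.aemeasurable,
      lintegral_const_mul _ (by fun_prop)]
    congr 2
    exact measurePreserving_fst.lintegral_comp hem
  have hφ₁ : Measurable fun p : (ℝ × ℝ) × (ℕ → ℝ × ℝ) => φ p.2 := hφm.comp measurable_snd
  have hφ₂ : Measurable fun p : (ℝ × ℝ) × (ℕ → ℝ × ℝ) => φ (seqCons p) :=
    hφm.comp measurable_seqCons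
  rw [lintegral_add_left hφ₁, lintegral_add_left hφ₂, hHf, hev,
    measurePreserving_snd.lintegral_comp hφm,
    measurePreserving_stickLaw_seqCons.lintegral_comp hφm] at hint
  exact (ENNReal.add_le_add_iff_left hfφ).1 hint

/-- If `log (1 + |B|)` is integrable but not square integrable, then the logarithm of the
absolute Dirichlet series is not integrable. -/
lemma lintegral_stickLog_eq_top (hα : ∫⁻ x, ENNReal.ofReal (Real.log (1 + ‖x‖)) ∂α < ∞)
    (hα₂ : ∫⁻ x, ENNReal.ofReal (Real.log (1 + ‖x‖) ^ 2) ∂α = ∞) :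
    ∫⁻ ω, ENNReal.ofReal (stickLog ω) ∂stickLaw 1 α = ∞ := by
  by_contra hfin
  obtain ⟨K, hK⟩ := exists_stickLaw_stickLog_le_ne_zero (α := α)
  set u : ℝ → ℝ := fun b => max (Real.log (1 + ‖b‖) - Real.log 2) 0 with hu
  set C := 2 * (∫⁻ y, ENNReal.ofReal (-Real.log (1 - y)) ∂betaMeasure 1 1) *
        ∫⁻ ω, ENNReal.ofReal (stickLog ω) ∂stickLaw 1 α
  have hC : C ≠ ∞ := ENNReal.mul_ne_top (ENNReal.mul_ne_top ENNReal.ofNat_ne_top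
    lintegral_neg_log_one_sub_betaMeasure_one_one_lt_top.ne) hfin
  set c := ENNReal.ofReal (1 / 2) * stickLaw 1 α {ω | stickLog ω ≤ K} with hc
  have hc0 : c ≠ 0 := mul_ne_zero (by simp) hK
  have hct : c ≠ ∞ := ENNReal.mul_ne_top ENNReal.ofReal_ne_top (measure_ne_top _ _)
  have hbound : ∀ M : ℕ, ∫⁻ b, ENNReal.ofReal (min (u b) M ^ 2 - (K : ℝ) ^ 2) ∂α ≤ C / c := by
    intro M
    rw [ENNReal.le_div_iff_mul_le (Or.inl hc0) (Or.inl hct), hc]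
    refine le_trans (le_of_eq ?_) (lintegral_sq_min_sub_le hα K M)
    ring
  have hu0 : ∀ b, 0 ≤ u b := fun b => le_max_right _ _
  have hum : Measurable u := (measurable_log_one_add_norm.sub_const _).max measurable_const
  have htend : Tendsto (fun M : ℕ => ∫⁻ b, ENNReal.ofReal (min (u b) M ^ 2 - (K : ℝ) ^ 2) ∂α) atTop
      (nhds (∫⁻ b, ENNReal.ofReal (u b ^ 2 - (K : ℝ) ^ 2) ∂α)) := by
    refine lintegral_tendsto_of_tendsto_of_monotone (fun M => by fun_prop)
      (Eventually.of_forall fun b M N hMN => ?_) (Eventually.of_forall fun b => ?_)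
    · have : min (u b) (M : ℝ) ^ 2 ≤ min (u b) (N : ℝ) ^ 2 :=
        pow_le_pow_left₀ (le_min (hu0 b) (Nat.cast_nonneg M))
          (min_le_min_left _ (Nat.cast_le.2 hMN)) 2
      exact ENNReal.ofReal_le_ofReal (by linarith)
    · obtain ⟨N, hN⟩ := exists_nat_ge (u b)
      refine tendsto_const_nhds.congr' ?_
      filter_upwards [eventually_ge_atTop N] with M hM
      rw [min_eq_left (hN.trans (Nat.cast_le.2 hM))]
  have hlim := le_of_tendsto' htend hbound
  refine absurd hα₂ (ne_of_lt ?_)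
  -- Uses `(u + log 2)^2 ≤ 2 u^2 + 2 (log 2)^2`; the constants are harmless under a probability.
  have hle : ∀ b : ℝ, ENNReal.ofReal (Real.log (1 + ‖b‖) ^ 2) ≤
      2 * ENNReal.ofReal (u b ^ 2 - (K : ℝ) ^ 2) +
        ENNReal.ofReal (2 * (K : ℝ) ^ 2 + 2 * Real.log 2 ^ 2) := by
    intro b
    have h1 : Real.log (1 + ‖b‖) ≤ u b + Real.log 2 := by
      linarith [le_max_left (Real.log (1 + ‖b‖) - Real.log 2) 0]
    have h2 : 0 ≤ Real.log (1 + ‖b‖) := Real.log_nonneg (by linarith [norm_nonneg b])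
    have h3 : Real.log (1 + ‖b‖) ^ 2 ≤
        2 * (u b ^ 2 - (K : ℝ) ^ 2) + (2 * (K : ℝ) ^ 2 + 2 * Real.log 2 ^ 2) := by
      nlinarith [sq_nonneg (u b - Real.log 2)]
    refine (ENNReal.ofReal_le_ofReal h3).trans (ENNReal.ofReal_add_le.trans ?_)
    rw [ENNReal.ofReal_mul zero_le_two, ENNReal.ofReal_ofNat]
  refine lt_of_le_of_lt (lintegral_mono hle) ?_
  rw [lintegral_add_right _ measurable_const, lintegral_const_mul _ (by fun_prop)]
  simp only [lintegral_const, measure_univ, mul_one]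
  exact ENNReal.add_lt_top.2 ⟨ENNReal.mul_lt_top ENNReal.ofNat_lt_top
    (lt_of_le_of_lt hlim (ENNReal.div_lt_top hC hc0)), ENNReal.ofReal_lt_top⟩

/-- For a parameter carried by `[0, ∞)` the Dirichlet series is its absolute series. -/
lemma ae_tsum_stickTerm_eq (hpos : ∀ᵐ x ∂α, 0 ≤ x) :
    ∀ᵐ ω ∂stickLaw 1 α, ∑' n, stickTerm ω n = (stickAbs ω).toReal := by
  filter_upwards [ae_stickLaw_snd hpos, ae_stickLaw_mem_Ioo] with ω hb hy
  -- No summability is needed: both sides take the default value `0` if the series diverges.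
  rw [stickAbs, ENNReal.tsum_toReal_eq fun n => enorm_ne_top]
  refine tsum_congr fun n => ?_
  rw [toReal_enorm, Real.norm_of_nonneg]
  exact mul_nonneg (mul_nonneg (hy n).1.le
    (Finset.prod_nonneg fun k _ => sub_nonneg.2 (hy k).2.le)) (hb n)

/-- Without this, `Measure.map` in `dirichletMean` could default to the zero measure. -/
lemma aemeasurable_tsum_stickTerm (hpos : ∀ᵐ x ∂α, 0 ≤ x) :
    AEMeasurable (fun ω => ∑' n, stickTerm ω n) (stickLaw 1 α) :=
  ⟨_, measurable_stickAbs.ennreal_toReal, ae_tsum_stickTerm_eq hpos⟩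

lemma lintegral_log_dirichletMean (hpos : ∀ᵐ x ∂α, 0 ≤ x) :
    ∫⁻ x, ENNReal.ofReal (Real.log (1 + ‖x‖)) ∂dirichletMean 1 α =
      ∫⁻ ω, ENNReal.ofReal (stickLog ω) ∂stickLaw 1 α := by
  rw [dirichletMean, lintegral_map' measurable_log_one_add_norm.ennreal_ofReal.aemeasurable
    (aemeasurable_tsum_stickTerm hpos)]
  refine lintegral_congr_ae ?_
  filter_upwards [ae_tsum_stickTerm_eq hpos] with ω hω
  rw [hω, Real.norm_of_nonneg ENNReal.toReal_nonneg, stickLog]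

end

/-! ### Logarithmic moments of the log-Pareto law -/

lemma one_le_one_add_log {w : ℝ} (hw : 0 ≤ w) : 1 ≤ 1 + Real.log (1 + w) := by
  linarith [Real.log_nonneg (by linarith : 1 ≤ 1 + w)]

lemma hasDerivAt_one_add_log {w : ℝ} (hw : 0 ≤ w) :
    HasDerivAt (fun w => 1 + Real.log (1 + w)) (1 / (1 + w)) w :=
  (((hasDerivAt_id w).const_add 1).log (by simp; linarith)).const_add 1

lemma tendsto_one_add_log : Tendsto (fun w => 1 + Real.log (1 + w)) atTop atTop :=
  tendsto_atTop_add_const_left _ _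
    (Real.tendsto_log_atTop.comp (tendsto_atTop_add_const_left _ _ tendsto_id))

lemma measurable_logPareto_density (a : ℝ) : Measurable fun w : ℝ =>
    ENNReal.ofReal (a / (1 + Real.log (1 + w)) ^ (a + 1) * (1 / (1 + w))) := by
  have : Measurable fun w : ℝ => Real.log (1 + w) := Real.measurable_log.comp (by fun_prop)
  fun_prop

lemma logPareto_density_nonneg {a w : ℝ} (ha : 0 ≤ a) (hw : 0 ≤ w) :
    0 ≤ a / (1 + Real.log (1 + w)) ^ (a + 1) * (1 / (1 + w)) := by
  have := one_le_one_add_log hw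
  positivity

lemma lintegral_logPareto_density {a : ℝ} (ha : 0 < a) :
    ∫⁻ w in Ioi 0, ENNReal.ofReal (a / (1 + Real.log (1 + w)) ^ (a + 1) * (1 / (1 + w))) = 1 := by
  have hderiv : ∀ w ∈ Ici (0 : ℝ), HasDerivAt (fun w => -(1 + Real.log (1 + w)) ^ (-a))
      (a / (1 + Real.log (1 + w)) ^ (a + 1) * (1 / (1 + w))) w := fun w hw => by
    have hl := one_le_one_add_log hw
    have h := ((hasDerivAt_one_add_log hw).rpow_const (p := -a) (Or.inl (by linarith))).neg
    convert! h using 1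
    rw [show -a - 1 = -(a + 1) by ring, Real.rpow_neg (by linarith)]
    ring
  have hnn : ∀ w ∈ Ioi (0 : ℝ), 0 ≤ a / (1 + Real.log (1 + w)) ^ (a + 1) * (1 / (1 + w)) :=
    fun w hw => logPareto_density_nonneg ha.le (le_of_lt hw)
  have hlim : Tendsto (fun w => -(1 + Real.log (1 + w)) ^ (-a)) atTop (nhds 0) := by
    simpa using ((tendsto_rpow_neg_atTop ha).comp tendsto_one_add_log).neg
  rw [← ofReal_integral_eq_lintegral_ofReal (integrableOn_Ioi_deriv_of_nonneg' hderiv hnn hlim)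
    ((ae_restrict_mem measurableSet_Ioi).mono hnn),
    integral_Ioi_of_hasDerivAt_of_nonneg' hderiv hnn hlim]
  simp

lemma isProbabilityMeasure_logPareto {a : ℝ} (ha : 0 < a) :
    IsProbabilityMeasure (logPareto a) :=
  ⟨by rw [logPareto, withDensity_apply _ MeasurableSet.univ, Measure.restrict_univ,
    lintegral_logPareto_density ha]⟩

lemma ae_logPareto_pos (a : ℝ) : ∀ᵐ x ∂logPareto a, 0 < x :=
  (withDensity_absolutelyContinuous _ _).ae_le (ae_restrict_mem measurableSet_Ioi)

lemma lintegral_logPareto {a : ℝ} (ha : 0 ≤ a) {f : ℝ → ℝ} (hf : Measurable f) :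
    ∫⁻ x, ENNReal.ofReal (f x) ∂logPareto a = ∫⁻ w in Ioi 0,
      ENNReal.ofReal (a / (1 + Real.log (1 + w)) ^ (a + 1) * (1 / (1 + w)) * f w) := by
  rw [logPareto, lintegral_withDensity_eq_lintegral_mul _ (measurable_logPareto_density a)
    hf.ennreal_ofReal]
  refine setLIntegral_congr_fun measurableSet_Ioi fun w hw => ?_
  exact (ENNReal.ofReal_mul (logPareto_density_nonneg ha (le_of_lt hw))).symm

/-- One logarithm lowers the exponent by one: the integrand is at most `a / (a - 1)` times the
density of parameter `a - 1 > 0`. -/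
lemma lintegral_log_logPareto_lt_top {a : ℝ} (ha : 1 < a) :
    ∫⁻ x, ENNReal.ofReal (Real.log (1 + ‖x‖)) ∂logPareto a < ∞ := by
  rw [lintegral_logPareto (by linarith) measurable_log_one_add_norm]
  have hle : ∀ w ∈ Ioi (0 : ℝ),
      ENNReal.ofReal (a / (1 + Real.log (1 + w)) ^ (a + 1) * (1 / (1 + w)) * Real.log (1 + ‖w‖)) ≤
      ENNReal.ofReal (a / (a - 1)) * ENNReal.ofReal
        ((a - 1) / (1 + Real.log (1 + w)) ^ (a - 1 + 1) * (1 / (1 + w))) := by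
    intro w hw
    have hw0 : 0 < w := hw
    have hl := one_le_one_add_log hw0.le
    have ha' : 0 < a - 1 := sub_pos.2 ha
    rw [← ENNReal.ofReal_mul (by positivity), Real.norm_of_nonneg hw0.le]
    refine ENNReal.ofReal_le_ofReal ?_
    have hl0 : 0 < 1 + Real.log (1 + w) := by linarith
    rw [sub_add_cancel, Real.rpow_add_one hl0.ne']
    have hr : 0 < (1 + Real.log (1 + w)) ^ a := Real.rpow_pos_of_pos hl0 a
    calc a / ((1 + Real.log (1 + w)) ^ a * (1 + Real.log (1 + w))) * (1 / (1 + w)) *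
          Real.log (1 + w)
        ≤ a / ((1 + Real.log (1 + w)) ^ a * (1 + Real.log (1 + w))) * (1 / (1 + w)) *
          (1 + Real.log (1 + w)) :=
          mul_le_mul_of_nonneg_left (by linarith) (by positivity)
      _ = a / (a - 1) * ((a - 1) / (1 + Real.log (1 + w)) ^ a * (1 / (1 + w))) := by
          field_simp
  refine lt_of_le_of_lt (setLIntegral_mono' measurableSet_Ioi hle) ?_
  rw [lintegral_const_mul _ (measurable_logPareto_density (a - 1)),
    lintegral_logPareto_density (sub_pos.2 ha), mul_one]
  exact ENNReal.ofReal_lt_top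

/-- For `a ≤ 2`, the density times `(1 + log (1 + w))^2` dominates the derivative of `a log (1 + log
(1 + w))`, which is unbounded. -/
lemma lintegral_log_sq_logPareto {a : ℝ} (ha : 0 < a) (ha₂ : a ≤ 2) :
    ∫⁻ x, ENNReal.ofReal (Real.log (1 + ‖x‖) ^ 2) ∂logPareto a = ∞ := by
  by_contra hfin
  have := isProbabilityMeasure_logPareto ha
  have h1 : ∫⁻ x, ENNReal.ofReal ((1 + Real.log (1 + ‖x‖)) ^ 2) ∂logPareto a < ∞ := by
    have hle : ∀ x : ℝ, ENNReal.ofReal ((1 + Real.log (1 + ‖x‖)) ^ 2) ≤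
        2 * ENNReal.ofReal (Real.log (1 + ‖x‖) ^ 2) + 2 := fun x => by
      have h : (1 + Real.log (1 + ‖x‖)) ^ 2 ≤ 2 * Real.log (1 + ‖x‖) ^ 2 + 2 := by
        nlinarith [sq_nonneg (1 - Real.log (1 + ‖x‖))]
      refine (ENNReal.ofReal_le_ofReal h).trans (ENNReal.ofReal_add_le.trans ?_)
      rw [ENNReal.ofReal_mul zero_le_two, ENNReal.ofReal_ofNat]
    refine lt_of_le_of_lt (lintegral_mono hle) ?_
    rw [lintegral_add_right _ measurable_const,
      lintegral_const_mul _ (measurable_log_one_add_norm.pow_const 2).ennreal_ofReal]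
    simp only [lintegral_const, measure_univ, mul_one]
    exact ENNReal.add_lt_top.2
      ⟨ENNReal.mul_lt_top ENNReal.ofNat_lt_top (lt_top_iff_ne_top.2 hfin), ENNReal.ofNat_lt_top⟩
  rw [lintegral_logPareto ha.le ((measurable_log_one_add_norm.const_add 1).pow_const 2)] at h1
  have hm : Measurable fun w : ℝ => Real.log (1 + w) := Real.measurable_log.comp (by fun_prop)
  have hint : IntegrableOn (fun w => a * (1 / (1 + w) / (1 + Real.log (1 + w)))) (Ioi 0) := by
    refine ⟨(by fun_prop : Measurable _).aestronglyMeasurable, ?_⟩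
    rw [hasFiniteIntegral_iff_ofReal]
    · refine lt_of_le_of_lt (setLIntegral_mono' measurableSet_Ioi fun w hw => ?_) h1
      have hw0 : 0 < w := hw
      have hl := one_le_one_add_log hw0.le
      have hl0 : 0 < 1 + Real.log (1 + w) := by linarith
      refine ENNReal.ofReal_le_ofReal ?_
      rw [Real.norm_of_nonneg hw0.le, Real.rpow_add_one hl0.ne']
      have hr : 0 < (1 + Real.log (1 + w)) ^ a := Real.rpow_pos_of_pos hl0 a
      have hr2 : (1 + Real.log (1 + w)) ^ a ≤ (1 + Real.log (1 + w)) ^ 2 := by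
        exact_mod_cast Real.rpow_le_rpow_of_exponent_le hl ha₂
      calc a * (1 / (1 + w) / (1 + Real.log (1 + w)))
          = a / ((1 + Real.log (1 + w)) ^ a * (1 + Real.log (1 + w))) * (1 / (1 + w)) *
            (1 + Real.log (1 + w)) ^ a := by field_simp
        _ ≤ _ := mul_le_mul_of_nonneg_left hr2 (by positivity)
    · filter_upwards [ae_restrict_mem measurableSet_Ioi] with w hw
      have hw0 : 0 < w := hw
      have hl := one_le_one_add_log hw0.le
      have hl0 : 0 < 1 + Real.log (1 + w) := by linarith
      simp only [Pi.zero_apply]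
      positivity
  have hderiv : ∀ᶠ w in atTop, HasDerivAt (fun w => a * Real.log (1 + Real.log (1 + w)))
      (a * (1 / (1 + w) / (1 + Real.log (1 + w)))) w := by
    filter_upwards [eventually_ge_atTop 0] with w hw
    have hl := one_le_one_add_log hw
    exact ((hasDerivAt_one_add_log hw).log (by linarith)).const_mul a
  exact not_integrableOn_of_tendsto_norm_atTop_of_deriv_isBigO_filter atTop (Ioi_mem_atTop 0)
    (hderiv.mono fun w h => h.differentiableAt)
    (tendsto_norm_atTop_atTop.comp
      ((Real.tendsto_log_atTop.comp tendsto_one_add_log).const_mul_atTop ha))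
    (EventuallyEq.isBigO (hderiv.mono fun w h => h.deriv)) hint

theorem proposition6p6 (a : ℝ) (ha₁ : 1 < a) (ha₂ : a ≤ 2) :
    logPareto a ∈ FT ℝ ∧
    (∀ᵐ ω ∂(stickLaw 1 (logPareto a)), Summable fun n => stickTerm ω n) ∧
    IsProbabilityMeasure (dirichletMean 1 (logPareto a)) ∧
    ∫⁻ x, ENNReal.ofReal (Real.log (1 + |x|)) ∂(dirichletMean 1 (logPareto a)) = ∞ ∧
    dirichletMean 1 (logPareto a) ∉ FT ℝ := by
  have ha : 0 < a := one_pos.trans ha₁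
  have := isProbabilityMeasure_logPareto ha
  have hpos : ∀ᵐ x ∂logPareto a, 0 ≤ x := (ae_logPareto_pos a).mono fun x => le_of_lt
  have hlog := lintegral_log_logPareto_lt_top ha₁
  have htop : ∫⁻ x, ENNReal.ofReal (Real.log (1 + ‖x‖)) ∂dirichletMean 1 (logPareto a) = ∞ := by
    rw [lintegral_log_dirichletMean hpos]
    exact lintegral_stickLog_eq_top hlog (lintegral_log_sq_logPareto ha ha₂)
  exact ⟨⟨this, hlog⟩, (ae_stickAbs_ne_top hlog).mono fun ω h => summable_of_stickAbs_ne_top h,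
    Measure.isProbabilityMeasure_map (aemeasurable_tsum_stickTerm hpos), htop,
    fun h => h.2.ne htop⟩
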